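/- Let $\mathcal A$ be a unital $C^*$-algebra with Banach dual $\mathcal A^*$, and let $(T_t^*)_{t\ge 0}$ be a $C_0^*$-semigroup of contractions on $\mathcal A^*$: each $T_t^*$ is a bounded linear operator with $\|T_t^*\|\le 1$, $T_t^*T_s^*=T_{t+s}^*$, $T_0^*=\mathrm{id}$, the function $t\mapsto (T_t^*\eta)(a)$ is continuous for all $\eta\in\mathcal A^*$, $a\in\mathcal A$, and $\eta\mapsto (T_t^*\eta)(a)$ is weak-$*$ continuous for all $t\ge0$, $a\in\mathcal A$. Let $L^*$ be its generator: $\eta\in D(L^*)$ and $L^*(\eta)=\theta$ if and only if $\frac1t(T_t^*\eta-\eta)\to\theta$ as $t\downarrow0$ in the weak-$*$ topology $\sigma(\mathcal A^*,\mathcal A)$. Then the following two conditions are equivalent: 1. each $T_t^*$ is positive (if $\eta(a)\ge0$ for all $a\ge 0$ in $\mathcal A$, then $(T_t^*\eta)(a)\ge0$ for all $a\ge 0$ in $\mathcal A$), and $T_t^*(\eta)(\mathbf 1)=\eta(\mathbf 1)$ for all $t\ge0$ and all $\eta\in\mathcal A^*$; 2. $L^*(\eta)(\mathbf 1)=0$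 for all $\eta\in D(L^*)$. The same equivalence, with $\mathcal A_*$ in place of $\mathcal A^*$, holds if $\mathcal A$ is a von Neumann algebra on a Hilbert space, $\mathcal A_*$ is its predual (the space of $\sigma$-weakly continuous functionals on $\mathcal A$, with the norm of $\mathcal A^*$), $(T_t^*)_{t\ge0}$ is a $C_0$-semigroup of contractions on $\mathcal A_*$ (bounded operators with $\|T_t^*\|\le 1$, $T_t^*T_s^*=T_{t+s}^*$, $T_0^*=\mathrm{id}$, and $\lim_{t\downarrow0}\|T_t^*\eta-\eta\|=0$ for all $\eta\in\mathcal A_*$), and $L^*$ is its generator, where the limit defining $L^*$ is taken in the weak topology of $\mathcal A_*$. -/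

import Mathlib

open Filter Topology
open scoped NNReal ComplexOrder InnerProductSpace

/-! ### One-parameter semigroups -/

/-- A strongly continuous (or `C₀`-) semigroup of bounded operators on a normed space. -/
structure IsC0Semigroup {X : Type*} [NormedAddCommGroup X] [NormedSpace ℂ X]
    (T : ℝ≥0 → X →L[ℂ] X) : Prop where
  comp_eq : ∀ t s, (T t).comp (T s) = T (t + s)
  zero_eq : T 0 = ContinuousLinearMap.id ℂ X
  tendsto_zero : ∀ x : X, Tendsto (fun t : ℝ≥0 => ‖T t x - x‖) (𝓝[>] 0) (𝓝 0)

/-- A `C₀*`-semigroup of bounded operators on the dual `Y*` of a normed space `Y`, the predual of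
`Y*` being `Y`: each orbit is weak-* continuous in time, and each operator is continuous for the
weak-* topology. -/
structure IsC0StarSemigroup {Y : Type*} [NormedAddCommGroup Y] [NormedSpace ℂ Y]
    (T : ℝ≥0 → StrongDual ℂ Y →L[ℂ] StrongDual ℂ Y) : Prop where
  comp_eq : ∀ t s, (T t).comp (T s) = T (t + s)
  zero_eq : T 0 = ContinuousLinearMap.id ℂ (StrongDual ℂ Y)
  continuous_orbit : ∀ (η : StrongDual ℂ Y) (y : Y), Continuous fun t : ℝ≥0 => T t η y
  continuous_weakStar : ∀ (y : Y) (t : ℝ≥0),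
    Continuous fun η : WeakDual ℂ Y => T t (WeakDual.toStrongDual η) y

/-- A semigroup of contractions. -/
def IsContractive {X : Type*} [NormedAddCommGroup X] [NormedSpace ℂ X]
    (T : ℝ≥0 → X →L[ℂ] X) : Prop :=
  ∀ t, ‖T t‖ ≤ 1

/-! ### Generators -/

/-- The graph of the generator of `T`, where the topology on `X` in which the limit of the
difference quotients is taken is the one transported from `W` by `j`: the pairs `(x, y)` with
`(T t x - x) / t → y` as `t ↓ 0`. -/
def generatorGraph {X W : Type*} [NormedAddCommGroup X] [NormedSpace ℂ X]
    [AddCommGroup W] [Module ℂ W] [TopologicalSpace W] [ContinuousAdd W] [ContinuousConstSMul ℂ W]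
    (j : X ≃ₗ[ℂ] W) (T : ℝ≥0 → X →L[ℂ] X) : Submodule ℂ (X × X) where
  carrier := {p | Tendsto (fun t : ℝ≥0 => j ((((t : ℝ) : ℂ)⁻¹) • (T t p.1 - p.1)))
    (𝓝[>] 0) (𝓝 (j p.2))}
  add_mem' := by
    intro p q hp hq
    have h := Tendsto.add hp hq
    simp only [Set.mem_ofPred_eq, Prod.fst_add, Prod.snd_add, map_add]
    refine h.congr fun t => ?_
    rw [← map_add, ← smul_add]
    congr 2
    abel
  zero_mem' := by
    simp [tendsto_const_nhds]
  smul_mem' := by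
    intro c p hp
    have h := Tendsto.const_smul hp c
    simp only [Set.mem_ofPred_eq, Prod.smul_fst, Prod.smul_snd, map_smul]
    refine h.congr fun t => ?_
    rw [← smul_sub, map_smul, map_smul, smul_comm]

/-- The generator, as an unbounded operator. -/
noncomputable def generator {X W : Type*} [NormedAddCommGroup X] [NormedSpace ℂ X]
    [AddCommGroup W] [Module ℂ W] [TopologicalSpace W] [ContinuousAdd W] [ContinuousConstSMul ℂ W]
    (j : X ≃ₗ[ℂ] W) (T : ℝ≥0 → X →L[ℂ] X) : X →ₗ.[ℂ] X :=
  (generatorGraph j T).toLinearPMap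

/-- Limits being unique, the graph of the generator is what it should be. -/
theorem generator_graph {X W : Type*} [NormedAddCommGroup X] [NormedSpace ℂ X]
    [AddCommGroup W] [Module ℂ W] [TopologicalSpace W] [ContinuousAdd W] [ContinuousConstSMul ℂ W]
    [T2Space W] (j : X ≃ₗ[ℂ] W) (T : ℝ≥0 → X →L[ℂ] X) :
    (generator j T).graph = generatorGraph j T := by
  refine Submodule.toLinearPMap_graph_eq _ ?_
  rintro ⟨x, y⟩ hx rfl
  have h : Tendsto (fun t : ℝ≥0 => j ((((t : ℝ) : ℂ)⁻¹) • (T t (0 : X) - 0)))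
    (𝓝[>] 0) (𝓝 (j y)) := hx
  simp only [map_zero, sub_zero, smul_zero] at h
  have := tendsto_nhds_unique h tendsto_const_nhds
  simpa using this

/-- The generator of a `C₀`-semigroup: the limit is taken in the weak topology. -/
noncomputable def c0Generator {X : Type*} [NormedAddCommGroup X] [NormedSpace ℂ X]
    (T : ℝ≥0 → X →L[ℂ] X) : X →ₗ.[ℂ] X :=
  generator (toWeakSpace ℂ X) T

/-- The generator of a `C₀*`-semigroup on `Y*`: the limit is taken in the weak-* topology. -/
noncomputable def c0StarGenerator {Y : Type*} [NormedAddCommGroup Y] [NormedSpace ℂ Y]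
    (T : ℝ≥0 → StrongDual ℂ Y →L[ℂ] StrongDual ℂ Y) : StrongDual ℂ Y →ₗ.[ℂ] StrongDual ℂ Y :=
  generator (StrongDual.toWeakDual (𝕜 := ℂ) (E := Y)) T

/-! ### Positive functionals and the predual of a von Neumann algebra -/

/-- A bounded functional is positive if it is nonnegative on the positive cone. -/
def IsPositiveFunctional {A : Type*} [AddCommMonoid A] [Module ℂ A] [TopologicalSpace A] [Preorder A]
    (η : StrongDual ℂ A) : Prop :=
  ∀ a : A, 0 ≤ a → 0 ≤ η a

section VonNeumann

variable {H : Type*} [NormedAddCommGroup H] [InnerProductSpace ℂ H] [CompleteSpace H]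

/-- The elements of a von Neumann algebra `M ⊆ B(H)`, as a type. -/
def VNElem (M : VonNeumannAlgebra H) : Type _ := M.toStarSubalgebra

/-- The bounded operator on `H` that an element of a von Neumann algebra is. -/
def VNElem.toOp {M : VonNeumannAlgebra H} (a : VNElem M) : H →L[ℂ] H :=
  Subtype.val (p := fun x => x ∈ M.toStarSubalgebra) a

/-- A von Neumann algebra is norm closed, being a commutant. -/
theorem isClosed_vonNeumannAlgebra (M : VonNeumannAlgebra H) :
    IsClosed (M.toStarSubalgebra : Set (H →L[ℂ] H)) := by
  have h : (M.toStarSubalgebra : Set (H →L[ℂ] H)) =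
      Set.centralizer (Set.centralizer (M : Set (H →L[ℂ] H))) :=
    M.centralizer_centralizer.symm
  rw [h]
  exact Set.isClosed_centralizer _

/-- The C*-algebra structure inherited from `B(H)`. -/
noncomputable instance VNElem.instCStarAlgebra (M : VonNeumannAlgebra H) : CStarAlgebra (VNElem M) :=
  haveI := isClosed_vonNeumannAlgebra M
  inferInstanceAs (CStarAlgebra M.toStarSubalgebra)

/-- The order inherited from `B(H)`; its positive cone is that of positive operators in `M`. -/
noncomputable instance VNElem.instPartialOrder (M : VonNeumannAlgebra H) : PartialOrder (VNElem M) :=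
  PartialOrder.lift VNElem.toOp Subtype.val_injective

/-- The functional `a ↦ ∑ₙ ⟪ξₙ, a ζₙ⟫` for square-summable sequences `ξ`, `ζ` of vectors. -/
noncomputable def sigmaWeakFunctional (M : VonNeumannAlgebra H)
    (p : lp (fun _ : ℕ => H) 2 × lp (fun _ : ℕ => H) 2) (a : VNElem M) : ℂ :=
  ∑' n, ⟪p.1 n, a.toOp (p.2 n)⟫_ℂ

/-- The series above always converges. -/
theorem summable_sigmaWeakFunctional (M : VonNeumannAlgebra H)
    (p : lp (fun _ : ℕ => H) 2 × lp (fun _ : ℕ => H) 2) (a : VNElem M) :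
    Summable fun n => ⟪p.1 n, a.toOp (p.2 n)⟫_ℂ := by
  have h (q : lp (fun _ : ℕ => H) 2) : Summable fun n => ‖q n‖ ^ 2 := by
    simpa using (lp.memℓp q).summable (by norm_num)
  refine Summable.of_norm_bounded
    (g := fun n => ‖a.toOp‖ * (‖p.1 n‖ ^ 2 + ‖p.2 n‖ ^ 2))
    (((h p.1).add (h p.2)).mul_left _) fun n => ?_
  calc ‖⟪p.1 n, a.toOp (p.2 n)⟫_ℂ‖
      ≤ ‖p.1 n‖ * ‖a.toOp (p.2 n)‖ := norm_inner_le_norm _ _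
    _ ≤ ‖p.1 n‖ * (‖a.toOp‖ * ‖p.2 n‖) := by
        gcongr
        exact ContinuousLinearMap.le_opNorm _ _
    _ = ‖a.toOp‖ * (‖p.1 n‖ * ‖p.2 n‖) := by ring
    _ ≤ _ := by
        gcongr
        nlinarith [sq_nonneg (‖p.1 n‖ - ‖p.2 n‖), sq_nonneg ‖p.1 n‖, sq_nonneg ‖p.2 n‖]

/-- The σ-weak topology of a von Neumann algebra: the coarsest topology that makes all the
functionals `a ↦ ∑ₙ ⟪ξₙ, a ζₙ⟫` continuous. -/
@[reducible] noncomputable def sigmaWeakTopology (M : VonNeumannAlgebra H) :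
    TopologicalSpace (VNElem M) :=
  TopologicalSpace.induced (fun a p => sigmaWeakFunctional M p a) Pi.topologicalSpace

/-- The σ-weakly continuous functionals on a von Neumann algebra, as a subspace of its dual. -/
noncomputable def predualSubmodule (M : VonNeumannAlgebra H) :
    Submodule ℂ (StrongDual ℂ (VNElem M)) where
  carrier := {η | Continuous[sigmaWeakTopology M, inferInstance] fun a => η a}
  add_mem' := by
    intro η θ hη hθ
    let _ := sigmaWeakTopology M
    exact Continuous.add (show Continuous[sigmaWeakTopology M, _] fun a => η a from hη)
      (show Continuous[sigmaWeakTopology M, _] fun a => θ a from hθ)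
  zero_mem' := by
    let _ := sigmaWeakTopology M
    exact continuous_const
  smul_mem' := by
    intro c η hη
    let _ := sigmaWeakTopology M
    exact Continuous.const_smul (show Continuous[sigmaWeakTopology M, _] fun a => η a from hη) c

/-- The predual `M_*` of a von Neumann algebra: the space of σ-weakly continuous functionals, with
the norm of the dual. -/
def Predual (M : VonNeumannAlgebra H) : Type _ := predualSubmodule M

noncomputable instance Predual.instNormedAddCommGroup (M : VonNeumannAlgebra H) : NormedAddCommGroup (Predual M) :=
  inferInstanceAs (NormedAddCommGroup (predualSubmodule M))

noncomputable instance Predual.instNormedSpace (M : VonNeumannAlgebra H) : NormedSpace ℂ (Predual M) :=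
  inferInstanceAs (NormedSpace ℂ (predualSubmodule M))

/-- The inclusion of the predual into the dual. -/
noncomputable def Predual.toDual {M : VonNeumannAlgebra H} :
    Predual M →ₗᵢ[ℂ] StrongDual ℂ (VNElem M) :=
  (predualSubmodule M).subtypeₗᵢ

end VonNeumann

/-!
The two conditions are linked by the integrals of the orbits. For every `x` in the space and every
`s`, the integral `z` of `u ↦ T u x` over `[0, s]` lies in the domain of the generator `L`, and
`L z = T s x - x`. So every difference `T s x - x` is in the range of `L`, and a functional
annihilates the range of `L` if and only if it is invariant under the semigroup
(`invariant_iff_generator_eq_zero`); this is used for the evaluation at `1`. For the dual of a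
C*-algebra, the integral is taken weak-*, and the preadjoint of `T t` exists because a weak-*
continuous functional is an evaluation. For the predual of a von Neumann algebra it is a Bochner
integral.

Invariance of the evaluation at `1` makes contractions positive: a functional `η` is positive if and
only if its norm is at most its value at `1`
(`IsPositiveFunctional.norm_eq`, `isPositiveFunctional_of_norm_le`).

The Bochner integral needs the predual of a von Neumann algebra `M` on `H` to be complete
(`Predual.instCompleteSpace`). The predual is the range of a contraction `Q` from `ℓ¹(H × H)` to the
dual of `M`, which maps unit vectors to normalized vector functionals `a ↦ ⟪ξ, a ζ⟫`. A bounded functional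
on the quotient of `ℓ¹(H × H)` by the kernel of `Q` is a bounded sesquilinear form on `H`, and its
operator commutes with the commutant of `M`, so that it is an element of `M`. By the Hahn–Banach
theorem, the norm of the quotient is therefore at most the norm of the dual of `M`, and a range with
preimages of controlled norm is closed.
-/

/-! ### Orbit integrals and the range of the generator -/

section Generator

variable {X W Y : Type*} [NormedAddCommGroup X] [NormedSpace ℂ X]
  [AddCommGroup W] [Module ℂ W] [TopologicalSpace W] [ContinuousAdd W] [ContinuousConstSMul ℂ W]

/-- The inclusion of `ℝ≥0` in `ℝ` maps right neighbourhoods of `0` to right neighbourhoods of `0`. -/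
theorem NNReal.tendsto_coe_nhdsGT_zero :
    Tendsto (fun t : ℝ≥0 => (t : ℝ)) (𝓝[>] 0) (𝓝[>] 0) := by
  refine tendsto_nhdsWithin_iff.2 ⟨?_, ?_⟩
  · exact (NNReal.continuous_coe.tendsto' 0 0 NNReal.coe_zero).mono_left nhdsWithin_le_nhds
  · filter_upwards [self_mem_nhdsWithin] with t ht
    exact NNReal.coe_pos.2 ht

/-- For continuous `F`, the derivative at `h = 0` of `∫ u in 0..s, F (u + h)` is `F s - F 0`. -/
theorem tendsto_slope_integral_translate {F : ℝ → ℂ} (hF : Continuous F) (s : ℝ) :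
    Tendsto (fun t : ℝ≥0 => ((t : ℝ) : ℂ)⁻¹ *
      ((∫ u in (0 : ℝ)..s, F (u + t)) - ∫ u in (0 : ℝ)..s, F u)) (𝓝[>] 0) (𝓝 (F s - F 0)) := by
  have hG (x : ℝ) : HasDerivAt (fun y => ∫ u in (0 : ℝ)..y, F u) (F x) x :=
    intervalIntegral.integral_hasDerivAt_right (hF.intervalIntegrable _ _)
      (hF.stronglyMeasurableAtFilter _ _) hF.continuousAt
  have hD := ((hG s).tendsto_slope_zero_right.sub (hG 0).tendsto_slope_zero_right).comp
    NNReal.tendsto_coe_nhdsGT_zero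
  refine hD.congr fun t => ?_
  have h1 : (∫ u in (0 : ℝ)..s, F (u + t)) = ∫ u in (t : ℝ)..(s + t), F u := by
    rw [intervalIntegral.integral_comp_add_right (fun u => F u), zero_add]
  have h2 : (∫ u in (t : ℝ)..(s + t), F u) =
      (∫ u in (0 : ℝ)..(s + t), F u) - ∫ u in (0 : ℝ)..t, F u :=
    (intervalIntegral.integral_interval_sub_left (hF.intervalIntegrable _ _)
      (hF.intervalIntegrable _ _)).symm
  simp only [Function.comp_apply, zero_add, intervalIntegral.integral_same, sub_zero, h1, h2,
    Complex.real_smul, Complex.ofReal_inv]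
  ring

/-- If the topology of `W` is the initial one for functionals `φ y`, each `T t` has a preadjoint on
these functionals, and the orbit `u ↦ T u x` has an integral `z` over `[0, s]` in the weak sense,
then `z` lies in the domain of the generator, and the generator maps it to `T s x - x`. -/
theorem integral_mem_generatorGraph (j : X ≃ₗ[ℂ] W) {T : ℝ≥0 → X →L[ℂ] X} (φ : Y → X →ₗ[ℂ] ℂ)
    (hφ : ∀ (f : ℝ≥0 → X) (x : X), (∀ y, Tendsto (fun t => φ y (f t)) (𝓝[>] 0) (𝓝 (φ y x))) →
      Tendsto (fun t => j (f t)) (𝓝[>] 0) (𝓝 (j x)))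
    (hcomp : ∀ t s, (T t).comp (T s) = T (t + s)) (hzero : T 0 = ContinuousLinearMap.id ℂ X)
    (hcont : ∀ x y, Continuous fun t => φ y (T t x))
    (hadj : ∀ t y, ∃ y', ∀ x, φ y (T t x) = φ y' x) {x z : X} {s : ℝ≥0}
    (hz : ∀ y, φ y z = ∫ u in (0 : ℝ)..s, φ y (T u.toNNReal x)) :
    (z, T s x - x) ∈ generatorGraph j T := by
  refine hφ _ _ fun y => ?_
  have hF : Continuous fun u : ℝ => φ y (T u.toNNReal x) :=
    (hcont x y).comp continuous_real_toNNReal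
  have h := tendsto_slope_integral_translate hF s
  simp only [Real.toNNReal_coe, Real.toNNReal_zero, hzero, ContinuousLinearMap.id_apply,
    ← map_sub] at h
  refine h.congr fun t => ?_
  rw [map_smul, map_sub, smul_eq_mul]
  congr 2
  · obtain ⟨y', hy'⟩ := hadj t y
    rw [hy', hz]
    refine intervalIntegral.integral_congr fun u hu => ?_
    rw [Set.uIcc_of_le s.coe_nonneg] at hu
    have : (u + t).toNNReal = t + u.toNNReal := by
      rw [Real.toNNReal_add hu.1 t.coe_nonneg, Real.toNNReal_coe, add_comm]
    simp only [← hy', this, ← hcomp, ContinuousLinearMap.comp_apply]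
  · exact (hz y).symm

/-- Under the hypotheses of `integral_mem_generatorGraph` for all orbits, a functional `φ e` of the
family is invariant under the semigroup if and only if it annihilates the range of the generator. -/
theorem invariant_iff_generator_eq_zero [T2Space W] (j : X ≃ₗ[ℂ] W) {T : ℝ≥0 → X →L[ℂ] X}
    (φ : Y → X →ₗ[ℂ] ℂ)
    (hφ : ∀ (f : ℝ≥0 → X) (x : X), Tendsto (fun t => j (f t)) (𝓝[>] 0) (𝓝 (j x)) ↔
      ∀ y, Tendsto (fun t => φ y (f t)) (𝓝[>] 0) (𝓝 (φ y x)))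
    (hcomp : ∀ t s, (T t).comp (T s) = T (t + s)) (hzero : T 0 = ContinuousLinearMap.id ℂ X)
    (hcont : ∀ x y, Continuous fun t => φ y (T t x))
    (hadj : ∀ t y, ∃ y', ∀ x, φ y (T t x) = φ y' x)
    (hint : ∀ (x : X) (s : ℝ≥0), ∃ z, ∀ y, φ y z = ∫ u in (0 : ℝ)..s, φ y (T u.toNNReal x))
    (e : Y) :
    (∀ t x, φ e (T t x) = φ e x) ↔ ∀ η : (generator j T).domain, φ e (generator j T η) = 0 := by
  constructor
  · intro h η
    have hη : ((η : X), generator j T η) ∈ generatorGraph j T := by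
      rw [← generator_graph]
      exact (generator j T).mem_graph η
    refine tendsto_nhds_unique ((hφ _ _).1 hη e) (tendsto_const_nhds.congr fun t => ?_)
    rw [map_smul, map_sub, h, sub_self, smul_zero]
  · intro h s x
    obtain ⟨z, hz⟩ := hint x s
    have hmem := integral_mem_generatorGraph j φ (fun f x => (hφ f x).2) hcomp hzero hcont hadj hz
    rw [← generator_graph, LinearPMap.mem_graph_iff] at hmem
    obtain ⟨η, -, hη⟩ := hmem
    have := h η
    rwa [hη, map_sub, sub_eq_zero] at this

end Generator

/-- For a `C₀*`-semigroup of contractions, an element `y` of the predual is invariant if and only if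
it annihilates the range of the generator. -/
theorem IsC0StarSemigroup.invariant_iff {Y : Type*} [NormedAddCommGroup Y] [NormedSpace ℂ Y]
    {T : ℝ≥0 → StrongDual ℂ Y →L[ℂ] StrongDual ℂ Y} (hT : IsC0StarSemigroup T)
    (hc : IsContractive T) (e : Y) :
    (∀ t η, T t η e = η e) ↔ ∀ η : (c0StarGenerator T).domain, c0StarGenerator T η e = 0 := by
  let φ (y : Y) : StrongDual ℂ Y →ₗ[ℂ] ℂ :=
    { toFun := fun η => η y, map_add' := fun _ _ => rfl, map_smul' := fun _ _ => rfl }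
  refine invariant_iff_generator_eq_zero (StrongDual.toWeakDual (𝕜 := ℂ) (E := Y)) φ
    (fun f x => ?_) hT.comp_eq hT.zero_eq hT.continuous_orbit (fun t y => ?_) (fun η s => ?_) e
  · exact tendsto_iff_forall_eval_tendsto_topDualPairing
  · -- a weak-* continuous functional is the evaluation at an element of `Y`
    let g : StrongDual ℂ (WeakBilin (topDualPairing ℂ Y)) :=
      { toFun := fun η => T t (WeakDual.toStrongDual (𝕜 := ℂ) (E := Y) η) y
        map_add' := fun η θ => by
          exact congrArg (fun ζ : StrongDual ℂ Y => ζ y) (map_add (T t) _ _)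
        map_smul' := fun c η => by
          exact congrArg (fun ζ : StrongDual ℂ Y => ζ y) (map_smul (T t) c _)
        cont := hT.continuous_weakStar y t }
    obtain ⟨y', hy'⟩ := LinearMap.dualEmbedding_surjective (topDualPairing ℂ Y) g
    exact ⟨y', fun η => (DFunLike.congr_fun hy' (StrongDual.toWeakDual η)).symm⟩
  · have hi (y : Y) : IntervalIntegrable (fun u : ℝ => T u.toNNReal η y) MeasureTheory.volume 0 s :=
      ((hT.continuous_orbit η y).comp continuous_real_toNNReal).intervalIntegrable _ _
    refine ⟨LinearMap.mkContinuous
      { toFun := fun y => ∫ u in (0 : ℝ)..s, T u.toNNReal η y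
        map_add' := fun y y' => by
          simp only [map_add]
          exact intervalIntegral.integral_add (hi y) (hi y')
        map_smul' := fun c y => by
          simp only [map_smul]
          exact intervalIntegral.integral_smul c _ } (‖η‖ * s) fun y => ?_, fun y => rfl⟩
    have hb (u : ℝ) : ‖T u.toNNReal η y‖ ≤ ‖η‖ * ‖y‖ :=
      (ContinuousLinearMap.le_opNorm _ _).trans (mul_le_mul_of_nonneg_right
        (((T u.toNNReal).le_of_opNorm_le (hc _) η).trans_eq (one_mul _)) (norm_nonneg _))
    refine (intervalIntegral.norm_integral_le_of_norm_le_const fun u _ => hb u).trans_eq ?_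
    rw [sub_zero, abs_of_nonneg s.coe_nonneg]
    ring

/-- The orbits of a `C₀`-semigroup of contractions are norm continuous. -/
theorem IsC0Semigroup.continuous_orbit {X : Type*} [NormedAddCommGroup X] [NormedSpace ℂ X]
    {T : ℝ≥0 → X →L[ℂ] X} (hT : IsC0Semigroup T) (hc : IsContractive T) (x : X) :
    Continuous fun t => T t x := by
  have hle (t h : ℝ≥0) : ‖T (t + h) x - T t x‖ ≤ ‖T h x - x‖ := by
    rw [← hT.comp_eq, ContinuousLinearMap.comp_apply, ← map_sub]
    exact ((T t).le_of_opNorm_le (hc t) _).trans_eq (one_mul _)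
  rw [Metric.continuous_iff]
  intro t ε hε
  have h0 := (hT.tendsto_zero x).eventually (gt_mem_nhds hε)
  rw [eventually_nhdsWithin_iff, Metric.eventually_nhds_iff] at h0
  obtain ⟨δ, hδ, h0⟩ := h0
  have hsmall (h : ℝ≥0) (hh : (h : ℝ) < δ) : ‖T h x - x‖ < ε := by
    rcases eq_or_ne h 0 with rfl | hne
    · simpa [hT.zero_eq] using hε
    · refine h0 ?_ (pos_iff_ne_zero.2 hne)
      rwa [NNReal.dist_eq, NNReal.coe_zero, sub_zero, abs_of_nonneg h.coe_nonneg]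
  refine ⟨δ, hδ, fun s hs => ?_⟩
  rw [NNReal.dist_eq] at hs
  rcases le_total s t with hst | hst
  · obtain ⟨h, rfl⟩ := exists_add_of_le hst
    rw [dist_comm, dist_eq_norm]
    refine (hle s h).trans_lt (hsmall h ?_)
    rwa [NNReal.coe_add, sub_add_cancel_left, abs_neg, abs_of_nonneg h.coe_nonneg] at hs
  · obtain ⟨h, rfl⟩ := exists_add_of_le hst
    rw [dist_eq_norm]
    refine (hle t h).trans_lt (hsmall h ?_)
    rwa [NNReal.coe_add, add_sub_cancel_left, abs_of_nonneg h.coe_nonneg] at hs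

/-- For a `C₀`-semigroup of contractions on a Banach space, a bounded functional is invariant if and
only if it annihilates the range of the generator. -/
theorem IsC0Semigroup.invariant_iff {X : Type*} [NormedAddCommGroup X] [NormedSpace ℂ X]
    [CompleteSpace X] {T : ℝ≥0 → X →L[ℂ] X} (hT : IsC0Semigroup T) (hc : IsContractive T)
    (e : StrongDual ℂ X) :
    (∀ t x, e (T t x) = e x) ↔ ∀ x : (c0Generator T).domain, e (c0Generator T x) = 0 := by
  have hcont := hT.continuous_orbit hc
  refine invariant_iff_generator_eq_zero (toWeakSpace ℂ X)
    (fun y : StrongDual ℂ X => (y : X →ₗ[ℂ] ℂ))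
    (fun f x => ?_) hT.comp_eq hT.zero_eq (fun x y => y.continuous.comp (hcont x))
    (fun t y => ⟨y.comp (T t), fun x => rfl⟩) (fun x s => ?_) e
  · exact WeakBilin.tendsto_iff_forall_eval_tendsto (B := (topDualPairing ℂ X).flip)
      fun x y h => (toWeakSpace ℂ X).injective (by
        by_contra hne
        obtain ⟨g, hg⟩ := SeparatingDual.exists_separating_of_ne (R := ℂ) (V := X) hne
        exact hg (DFunLike.congr_fun h g))
  · refine ⟨∫ u in (0 : ℝ)..s, T u.toNNReal x, fun y => ?_⟩
    exact (y.intervalIntegral_comp_comm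
      (((hcont x).comp continuous_real_toNNReal).intervalIntegrable _ _)).symm

/-! ### Positivity and the norm of functionals -/

section Positivity

variable {A : Type*} [CStarAlgebra A] [PartialOrder A] [StarOrderedRing A]

/-- A positive functional attains its norm at `1`, by the Cauchy–Schwarz inequality. -/
theorem IsPositiveFunctional.norm_eq {η : StrongDual ℂ A} (hη : IsPositiveFunctional η) :
    (‖η‖ : ℂ) = η 1 := by
  have h1 : 0 ≤ η 1 := hη 1 zero_le_one
  obtain ⟨c, hc0, hc⟩ : ∃ c : ℝ, 0 ≤ c ∧ η 1 = c :=
    ⟨(η 1).re, (Complex.nonneg_iff.1 h1).1, Complex.ext rfl (Complex.nonneg_iff.1 h1).2.symm⟩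
  let f : A →ₚ[ℂ] ℂ := PositiveLinearMap.mk₀ (η : A →ₗ[ℂ] ℂ) hη
  have hsq (a : A) : ((‖f.toPreGNS a‖ ^ 2 : ℝ) : ℂ) = η (star a * a) := by
    rw [Complex.ofReal_pow]
    exact f.preGNS_norm_sq (f.toPreGNS a)
  have hb (a : A) : ‖f.toPreGNS a‖ ^ 2 ≤ c * ‖a‖ ^ 2 := by
    rw [← Complex.real_le_real, hsq, Complex.ofReal_mul, ← hc]
    have := hη _ (sub_nonneg.2 (CStarAlgebra.star_mul_le_algebraMap_norm_sq (a := a)))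
    rw [map_sub, sub_nonneg, Algebra.algebraMap_eq_smul_one, ← Complex.coe_smul, map_smul,
      smul_eq_mul, mul_comm] at this
    exact this
  have h1sq : ‖f.toPreGNS (1 : A)‖ ^ 2 = c := by
    apply Complex.ofReal_injective
    rw [hsq, star_one, one_mul, hc]
  have hle : ‖η‖ ≤ c := by
    refine η.opNorm_le_bound hc0 fun a => ?_
    have hCS := norm_inner_le_norm (𝕜 := ℂ) (f.toPreGNS 1) (f.toPreGNS a)
    have hin : ⟪f.toPreGNS 1, f.toPreGNS a⟫_ℂ = η a := by
      rw [PositiveLinearMap.preGNS_inner_def]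
      simp only [PositiveLinearMap.ofPreGNS_toPreGNS, star_one, one_mul]
      rfl
    rw [hin] at hCS
    refine hCS.trans (abs_le_of_sq_le_sq' ?_ (by positivity)).2
    rw [mul_pow, h1sq, mul_pow]
    nlinarith [hb a]
  have hge : c ≤ ‖η‖ := by
    have h1n : ‖(1 : A)‖ ≤ 1 := by
      nontriviality A
      exact CStarRing.norm_one.le
    have := η.le_of_opNorm_le_of_le le_rfl h1n
    rwa [hc, mul_one, Complex.norm_real, Real.norm_of_nonneg hc0] at this
  rw [hc, le_antisymm hle hge]

/-- A functional of norm at most its value at `1` is positive. For selfadjoint `a`, the bound at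
`a + i t` for all real `t` forces `φ a` to be real; for `a ≥ 0`, the bound at `‖a‖ - a`, an element
of norm at most `‖a‖`, forces `φ a ≥ 0`. -/
theorem isPositiveFunctional_of_norm_le {φ : StrongDual ℂ A} {c : ℝ} (hn : ‖φ‖ ≤ c)
    (h1 : φ 1 = c) : IsPositiveFunctional φ := by
  have hc : 0 ≤ c := (norm_nonneg φ).trans hn
  intro a ha
  have hb (b : A) : ‖φ b‖ ≤ c * ‖b‖ := φ.le_of_opNorm_le hn b
  have hsa : IsSelfAdjoint a := IsSelfAdjoint.of_nonneg ha
  have him : (φ a).im = 0 := by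
    have key (t : ℝ) : ((φ a).im + t * c) ^ 2 ≤ c ^ 2 * (‖a‖ ^ 2 + t ^ 2) := by
      have hφ : φ (a + (t * Complex.I) • (1 : A)) = φ a + t * Complex.I * c := by
        rw [map_add, map_smul, h1, smul_eq_mul]
      have hI : (φ a + t * Complex.I * c).im = (φ a).im + t * c := by simp
      have hnorm : ‖a + (t * Complex.I) • (1 : A)‖ ^ 2 ≤ ‖a‖ ^ 2 + t ^ 2 := by
        have hmul : star (a + (t * Complex.I) • (1 : A)) * (a + (t * Complex.I) • (1 : A)) =
            star a * a + ((t ^ 2 : ℝ) : ℂ) • (1 : A) := by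
          have hI2 : (t : ℂ) * Complex.I * (t * Complex.I) = -((t ^ 2 : ℝ) : ℂ) := by
            rw [mul_mul_mul_comm, Complex.I_mul_I]
            push_cast
            ring
          have hst : star ((t : ℂ) * Complex.I) = -(t * Complex.I) := by simp
          rw [star_add, star_smul, star_one, hst, hsa.star_eq]
          simp only [mul_add, add_mul, smul_mul_assoc, mul_smul_comm, one_mul, mul_one, neg_smul,
            smul_smul, neg_mul, smul_add, smul_neg, hI2]
          abel
        have h1n : ‖(1 : A)‖ ≤ 1 := by
          nontriviality A
          exact CStarRing.norm_one.le
        rw [sq, ← CStarRing.norm_star_mul_self, hmul]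
        refine (norm_add_le _ _).trans (add_le_add ?_ ?_)
        · rw [CStarRing.norm_star_mul_self, sq]
        · rw [norm_smul, Complex.norm_real, Real.norm_of_nonneg (sq_nonneg t)]
          exact mul_le_of_le_one_right (sq_nonneg t) h1n
      have h2 : |(φ a).im + t * c| ≤ c * ‖a + (t * Complex.I) • (1 : A)‖ := by
        rw [← hI, ← hφ]
        exact (Complex.abs_im_le_norm _).trans (hb _)
      calc ((φ a).im + t * c) ^ 2 ≤ (c * ‖a + (t * Complex.I) • (1 : A)‖) ^ 2 :=
            sq_le_sq' (abs_le.1 h2).1 (abs_le.1 h2).2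
        _ ≤ _ := by
            rw [mul_pow]
            exact mul_le_mul_of_nonneg_left hnorm (sq_nonneg c)
    rcases hc.eq_or_lt with rfl | hc
    · have := hb a
      rw [zero_mul, norm_le_zero_iff] at this
      rw [this, Complex.zero_im]
    · by_contra hne
      -- this `t` makes the cross term `2 t c Im (φ a)` equal to `c² ‖a‖²`
      have := key (c * ‖a‖ ^ 2 / (2 * (φ a).im))
      have hcross : 2 * (φ a).im * (c * ‖a‖ ^ 2 / (2 * (φ a).im) * c) = c ^ 2 * ‖a‖ ^ 2 := by
        field_simp
      nlinarith [sq_pos_of_ne_zero hne]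
  have hre : 0 ≤ (φ a).re := by
    have h2 : ‖(‖a‖ : ℂ) • (1 : A) - a‖ ≤ ‖a‖ := by
      have halg : (‖a‖ : ℂ) • (1 : A) = algebraMap ℝ A ‖a‖ := by
        rw [Algebra.algebraMap_eq_smul_one, Complex.coe_smul]
      rw [halg]
      refine (CStarAlgebra.norm_le_iff_le_algebraMap _ (norm_nonneg a)
        (sub_nonneg.2 hsa.le_algebraMap_norm_self)).2 (sub_le_self _ ha)
    have h3 := (Complex.re_le_norm _).trans ((hb _).trans (mul_le_mul_of_nonneg_left h2 hc))
    rw [map_sub, map_smul, h1, smul_eq_mul, ← Complex.ofReal_mul, Complex.sub_re,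
      Complex.ofReal_re] at h3
    linarith
  exact Complex.nonneg_iff.2 ⟨hre, him.symm⟩

end Positivity

/-! ### The order of a von Neumann algebra -/

section VonNeumannOrder

variable {H : Type*} [NormedAddCommGroup H] [InnerProductSpace ℂ H] [CompleteSpace H]
  (M : VonNeumannAlgebra H)

/-- Positivity in a von Neumann algebra is that of its C*-algebra structure: by spectral permanence,
an element of `M` that is positive as an operator has nonnegative spectrum in `M`. -/
instance VNElem.instStarOrderedRing : StarOrderedRing (VNElem M) := by
  refine StarOrderedRing.of_nonneg_iff' (fun {x y} h z => ?_) fun a => ⟨fun ha => ?_, ?_⟩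
  · exact add_le_add_right (α := H →L[ℂ] H) h z.toOp
  · have ha' : 0 ≤ a.toOp := ha
    have hsa : IsSelfAdjoint a := Subtype.ext (IsSelfAdjoint.of_nonneg ha').star_eq
    have hspec : QuasispectrumRestricts a ContinuousMap.realToNNReal := by
      rw [quasispectrumRestricts_iff_spectrumRestricts, SpectrumRestricts.nnreal_iff]
      intro x hx
      refine spectrum_nonneg_of_nonneg ha' (x := x) fun hu => hx ?_
      have := isClosed_vonNeumannAlgebra M
      exact (StarSubalgebra.coe_isUnit M.toStarSubalgebra
        (a := (algebraMap ℝ (VNElem M) x - a : VNElem M))).1 hu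
    let := CStarAlgebra.spectralOrder (VNElem M)
    have := CStarAlgebra.spectralOrderedRing (VNElem M)
    exact CStarAlgebra.nonneg_iff_eq_star_mul_self.1
      (nonneg_iff_isSelfAdjoint_and_quasispectrumRestricts.2 ⟨hsa, hspec⟩)
  · rintro ⟨s, rfl⟩
    exact star_mul_self_nonneg s.toOp

end VonNeumannOrder

/-! ### The predual as a quotient of an `ℓ¹` space -/

section PredualComplete

theorem summable_norm_lp_one {ι : Type*} (v : lp (fun _ : ι => ℂ) 1) : Summable fun i => ‖v i‖ := by
  simpa using (lp.memℓp v).summable (by norm_num)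

theorem summable_norm_sq_lp_two {E : Type*} [NormedAddCommGroup E] (ξ : lp (fun _ : ℕ => E) 2) :
    Summable fun n => ‖ξ n‖ ^ 2 := by
  simpa using (lp.memℓp ξ).summable (by norm_num)

open Classical in
/-- The element of `ℓ¹(E × E)` of norm `‖ξ‖ * ‖ζ‖` that represents the vector functional of
`(ξ, ζ)`. -/
noncomputable def vectorFunctionalLift {E : Type*} [NormedAddCommGroup E] (p : E × E) :
    lp (fun _ : E × E => ℂ) 1 :=
  lp.single 1 p ((‖p.1‖ * ‖p.2‖ : ℝ) : ℂ)

theorem norm_vectorFunctionalLift {E : Type*} [NormedAddCommGroup E] (p : E × E) :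
    ‖vectorFunctionalLift p‖ = ‖p.1‖ * ‖p.2‖ := by
  classical
  rw [vectorFunctionalLift, lp.norm_single (by norm_num), Complex.norm_real,
    Real.norm_of_nonneg (by positivity)]

variable {H : Type*} [NormedAddCommGroup H] [InnerProductSpace ℂ H] [CompleteSpace H]
  (M : VonNeumannAlgebra H)

theorem VNElem.norm_toOp (a : VNElem M) : ‖a.toOp‖ = ‖a‖ := rfl

/-- An operator that commutes with the commutant of `M` lies in `M`. -/
theorem VonNeumannAlgebra.exists_toOp_eq {x : H →L[ℂ] H}
    (hx : ∀ b ∈ Set.centralizer (M : Set (H →L[ℂ] H)), b * x = x * b) :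
    ∃ a : VNElem M, a.toOp = x := by
  have : x ∈ (M : Set (H →L[ℂ] H)) := by
    rw [← M.centralizer_centralizer]
    exact hx
  exact ⟨⟨x, this⟩, rfl⟩

/-- The vector functional `a ↦ ⟪ξ, a ζ⟫` on a von Neumann algebra. -/
noncomputable def vectorFunctional (p : H × H) : StrongDual ℂ (VNElem M) :=
  LinearMap.mkContinuous
    { toFun := fun a => ⟪p.1, a.toOp p.2⟫_ℂ
      map_add' := fun a b => inner_add_right p.1 (a.toOp p.2) (b.toOp p.2)
      map_smul' := fun c a => inner_smul_right p.1 (a.toOp p.2) c } (‖p.1‖ * ‖p.2‖) fun a =>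
    calc ‖⟪p.1, a.toOp p.2⟫_ℂ‖ ≤ ‖p.1‖ * ‖a.toOp p.2‖ := norm_inner_le_norm _ _
      _ ≤ ‖p.1‖ * (‖a.toOp‖ * ‖p.2‖) :=
        mul_le_mul_of_nonneg_left (a.toOp.le_opNorm _) (norm_nonneg _)
      _ = ‖p.1‖ * ‖p.2‖ * ‖a‖ := by rw [VNElem.norm_toOp]; ring

theorem vectorFunctional_apply (p : H × H) (a : VNElem M) :
    vectorFunctional M p a = ⟪p.1, a.toOp p.2⟫_ℂ := rfl

theorem norm_vectorFunctional_le (p : H × H) : ‖vectorFunctional M p‖ ≤ ‖p.1‖ * ‖p.2‖ :=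
  LinearMap.mkContinuous_norm_le _ (by positivity) _

/-- The vector functional divided by the product of the norms of the two vectors; it is zero if one
of the vectors is. -/
noncomputable def normalizedVectorFunctional (p : H × H) : StrongDual ℂ (VNElem M) :=
  ((‖p.1‖ * ‖p.2‖ : ℝ) : ℂ)⁻¹ • vectorFunctional M p

theorem norm_normalizedVectorFunctional_le (p : H × H) :
    ‖normalizedVectorFunctional M p‖ ≤ 1 := by
  rw [normalizedVectorFunctional, norm_smul, norm_inv, Complex.norm_real,
    Real.norm_of_nonneg (by positivity)]
  exact inv_mul_le_one_of_le₀ (norm_vectorFunctional_le M p) (by positivity)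

theorem smul_normalizedVectorFunctional (p : H × H) :
    ((‖p.1‖ * ‖p.2‖ : ℝ) : ℂ) • normalizedVectorFunctional M p = vectorFunctional M p := by
  rcases eq_or_ne (‖p.1‖ * ‖p.2‖) 0 with h | h
  · have := norm_vectorFunctional_le M p
    rw [h, norm_le_zero_iff] at this
    rw [h, this, Complex.ofReal_zero]
    exact zero_smul ℂ (normalizedVectorFunctional M p)
  · rw [normalizedVectorFunctional, smul_smul, mul_inv_cancel₀ (Complex.ofReal_ne_zero.2 h),
      one_smul]

theorem norm_smul_normalizedVectorFunctional_le (c : ℂ) (p : H × H) :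
    ‖c • normalizedVectorFunctional M p‖ ≤ ‖c‖ := by
  rw [norm_smul]
  exact mul_le_of_le_one_right (norm_nonneg _) (norm_normalizedVectorFunctional_le M p)

theorem summable_smul_normalizedVectorFunctional (v : lp (fun _ : H × H => ℂ) 1) :
    Summable fun p => v p • normalizedVectorFunctional M p :=
  (summable_norm_lp_one v).of_norm_bounded fun p =>
    norm_smul_normalizedVectorFunctional_le M (v p) p

/-- The contraction from `ℓ¹(H × H)` to the dual of `M` that maps the unit vector at a pair of
vectors to the normalized vector functional. -/
noncomputable def vectorFunctionalSum :
    lp (fun _ : H × H => ℂ) 1 →L[ℂ] StrongDual ℂ (VNElem M) :=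
  LinearMap.mkContinuous
    { toFun := fun v => ∑' p, v p • normalizedVectorFunctional M p
      map_add' := fun v w => by
        rw [← (summable_smul_normalizedVectorFunctional M v).tsum_add
          (summable_smul_normalizedVectorFunctional M w)]
        exact tsum_congr fun p => add_smul (v p) (w p) (normalizedVectorFunctional M p)
      map_smul' := fun c v => by
        rw [RingHom.id_apply, ← (summable_smul_normalizedVectorFunctional M v).tsum_const_smul]
        exact tsum_congr fun p => smul_assoc c (v p) (normalizedVectorFunctional M p) } 1 fun v => by
    refine (tsum_of_norm_bounded (summable_norm_lp_one v).hasSum fun p =>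
      norm_smul_normalizedVectorFunctional_le M (v p) p).trans_eq ?_
    simp [lp.norm_eq_tsum_rpow (p := 1) (by norm_num) v]

theorem vectorFunctionalSum_apply (v : lp (fun _ : H × H => ℂ) 1) :
    vectorFunctionalSum M v = ∑' p, v p • normalizedVectorFunctional M p := rfl

open Classical in
theorem vectorFunctionalSum_single (p : H × H) (c : ℂ) :
    vectorFunctionalSum M (lp.single 1 p c) = c • normalizedVectorFunctional M p := by
  rw [vectorFunctionalSum_apply, tsum_eq_single p, lp.single_apply_self]
  intro q hq
  rw [lp.single_apply_ne _ _ _ hq]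
  exact zero_smul ℂ (normalizedVectorFunctional M q)

theorem vectorFunctionalSum_lift (p : H × H) :
    vectorFunctionalSum M (vectorFunctionalLift p) = vectorFunctional M p := by
  rw [vectorFunctionalLift, vectorFunctionalSum_single, smul_normalizedVectorFunctional]

/-- A contractive functional on `ℓ¹(H × H)` that factors through `vectorFunctionalSum M` is the
evaluation at an element of the unit ball of `M`: it defines a bounded sesquilinear form on `H`, and
the operator of this form commutes with the commutant of `M`. -/
theorem exists_eval_of_ker_le {l : StrongDual ℂ (lp (fun _ : H × H => ℂ) 1)} (hl : ‖l‖ ≤ 1)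
    (hker : ∀ v, vectorFunctionalSum M v = 0 → l v = 0) :
    ∃ a : VNElem M, ‖a‖ ≤ 1 ∧ ∀ v, l v = vectorFunctionalSum M v a := by
  have hfac {v w} (h : vectorFunctionalSum M v = vectorFunctionalSum M w) : l v = l w := by
    rw [← sub_eq_zero, ← map_sub]
    exact hker _ (by rw [map_sub, h, sub_self])
  let b (ξ ζ : H) : ℂ := l (vectorFunctionalLift (ξ, ζ))
  have hb (ξ ζ : H) : ‖b ξ ζ‖ ≤ 1 * ‖ξ‖ * ‖ζ‖ := by
    rw [mul_assoc]
    exact l.le_of_opNorm_le_of_le hl (norm_vectorFunctionalLift _).le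
  let B : H →L⋆[ℂ] H →L[ℂ] ℂ := LinearMap.mkContinuous₂
    (LinearMap.mk₂'ₛₗ (starRingEnd ℂ) (RingHom.id ℂ) b
      (fun ξ ξ' ζ => by
        rw [← map_add]
        refine hfac ?_
        ext a
        simp only [map_add, vectorFunctionalSum_lift, add_apply,
          vectorFunctional_apply, inner_add_left])
      (fun c ξ ζ => by
        rw [← map_smul]
        refine hfac ?_
        ext a
        simp only [map_smul, vectorFunctionalSum_lift, smul_apply,
          vectorFunctional_apply, inner_smul_left, smul_eq_mul])
      (fun ξ ζ ζ' => by
        rw [← map_add]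
        refine hfac ?_
        ext a
        simp only [map_add, vectorFunctionalSum_lift, add_apply,
          vectorFunctional_apply, inner_add_right])
      (fun c ξ ζ => by
        rw [RingHom.id_apply, ← map_smul]
        refine hfac ?_
        ext a
        simp only [map_smul, vectorFunctionalSum_lift, smul_apply,
          vectorFunctional_apply, inner_smul_right, smul_eq_mul])) 1 hb
  let x : H →L[ℂ] H := ContinuousLinearMap.adjoint (InnerProductSpace.continuousLinearMapOfBilin B)
  have hx (ξ ζ : H) : ⟪ξ, x ζ⟫_ℂ = b ξ ζ := by
    rw [ContinuousLinearMap.adjoint_inner_right,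
      InnerProductSpace.continuousLinearMapOfBilin_apply]
    rfl
  have hxn : ‖x‖ ≤ 1 := by
    refine x.opNorm_le_bound zero_le_one fun ζ => ?_
    rcases (norm_nonneg (x ζ)).eq_or_lt with h | h
    · rw [← h]
      positivity
    · refine le_of_mul_le_mul_left ?_ h
      have h1 := hb (x ζ) ζ
      rw [← hx, inner_self_eq_norm_sq_to_K] at h1
      simp only [norm_pow, RCLike.norm_ofReal, abs_norm] at h1
      linarith
  obtain ⟨a, ha⟩ := M.exists_toOp_eq (x := x) fun c hc => by
    ext ζ
    refine ext_inner_left ℂ fun ξ => ?_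
    simp only [mul_apply_eq_comp]
    rw [← ContinuousLinearMap.adjoint_inner_left, hx, hx]
    refine hfac ?_
    ext d
    simp only [vectorFunctionalSum_lift, vectorFunctional_apply,
      ContinuousLinearMap.adjoint_inner_left]
    -- `c` lies in the commutant of `M`, and `d` in `M`
    rw [← mul_apply_eq_comp, ← mul_apply_eq_comp, hc d.toOp d.2]
  refine ⟨a, by rwa [← VNElem.norm_toOp, ha], fun v => ?_⟩
  have hev : l = (ContinuousLinearMap.apply ℂ ℂ a).comp (vectorFunctionalSum M) := by
    classical
    refine lp.ext_continuousLinearMap ENNReal.one_ne_top fun p => ?_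
    ext
    simp only [ContinuousLinearMap.comp_apply, lp.singleContinuousLinearMap_apply,
      ContinuousLinearMap.apply_apply]
    have h1 : vectorFunctionalSum M (lp.single 1 p (1 : ℂ)) = vectorFunctionalSum M
        (((‖p.1‖ * ‖p.2‖ : ℝ) : ℂ)⁻¹ • vectorFunctionalLift p) := by
      rw [vectorFunctionalSum_single, map_smul, vectorFunctionalSum_lift, one_smul,
        normalizedVectorFunctional]
    rw [h1, hfac h1, map_smul, map_smul, smul_apply, vectorFunctionalSum_lift,
      vectorFunctional_apply, ha, hx]
  rw [hev]
  rfl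

/-- Elements of the range of `vectorFunctionalSum M` have preimages of norm at most twice their own:
by the Hahn–Banach theorem and `exists_eval_of_ker_le`, the norm of `ℓ¹(H × H)` modulo the kernel
is at most the norm of the dual. -/
theorem exists_vectorFunctionalSum_eq_norm_le (v : lp (fun _ : H × H => ℂ) 1) :
    ∃ w, vectorFunctionalSum M w = vectorFunctionalSum M v ∧
      ‖w‖ ≤ 2 * ‖vectorFunctionalSum M v‖ := by
  rcases eq_or_ne (vectorFunctionalSum M v) 0 with h0 | h0
  · exact ⟨0, by rw [h0, map_zero], by rw [norm_zero]; positivity⟩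
  let K : Submodule ℂ (lp (fun _ : H × H => ℂ) 1) := (vectorFunctionalSum M).ker
  have hK : IsClosed (K : Set (lp (fun _ : H × H => ℂ) 1)) := (vectorFunctionalSum M).isClosed_ker
  have hmk : ‖(Submodule.Quotient.mk v : _ ⧸ K)‖ ≤ ‖vectorFunctionalSum M v‖ := by
    obtain ⟨g, hg1, hg2⟩ := exists_dual_vector'' ℂ (Submodule.Quotient.mk v : _ ⧸ K)
    have hbound (w) : ‖(g : (_ ⧸ K) →ₗ[ℂ] ℂ).comp K.mkQ w‖ ≤ 1 * ‖w‖ := by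
      refine (g.le_of_opNorm_le hg1 _).trans ?_
      rw [one_mul, one_mul]
      exact Submodule.Quotient.norm_mk_le K w
    obtain ⟨a, ha, hev⟩ := exists_eval_of_ker_le M
      (l := LinearMap.mkContinuous ((g : (_ ⧸ K) →ₗ[ℂ] ℂ).comp K.mkQ) 1 hbound)
      (LinearMap.mkContinuous_norm_le _ zero_le_one _) fun w hw => by
        have : (Submodule.Quotient.mk w : _ ⧸ K) = 0 := (Submodule.Quotient.mk_eq_zero K).2 hw
        exact (congrArg g this).trans (map_zero g)
    have h1 : (‖(Submodule.Quotient.mk v : _ ⧸ K)‖ : ℂ) = vectorFunctionalSum M v a :=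
      hg2.symm.trans (hev v)
    have h2 := (vectorFunctionalSum M v).le_of_opNorm_le_of_le le_rfl ha
    rwa [← h1, Complex.norm_real, norm_norm, mul_one] at h2
  obtain ⟨w, hw, hlt⟩ := Submodule.Quotient.norm_mk_lt (Submodule.Quotient.mk v : _ ⧸ K)
    (norm_pos_iff.2 h0)
  refine ⟨w, ?_, by linarith⟩
  have := (Submodule.Quotient.eq K).1 hw
  rw [← sub_eq_zero, ← map_sub]
  exact this

/-- The functionals in the range of `vectorFunctionalSum M` form a norm closed set. -/
theorem isClosed_range_vectorFunctionalSum : IsClosed (Set.range (vectorFunctionalSum M)) := by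
  let f : NormedAddGroupHom (lp (fun _ : H × H => ℂ) 1) (StrongDual ℂ (VNElem M)) :=
    { toFun := vectorFunctionalSum M
      map_add' := map_add _
      bound' := ⟨_, (vectorFunctionalSum M).le_opNorm⟩ }
  have hf : f.SurjectiveOnWith f.range 2 := by
    rintro _ ⟨v, rfl⟩
    exact exists_vectorFunctionalSum_eq_norm_le M v
  have hf' := controlled_closure_of_complete two_pos one_pos hf
  refine isClosed_of_closure_subset fun η hη => ?_
  obtain ⟨v, hv, -⟩ := hf' η hη
  exact ⟨v, hv⟩

/-- The functionals that define the σ-weak topology are in the range of `vectorFunctionalSum M`. -/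
theorem exists_vectorFunctionalSum_eq_sigmaWeakFunctional
    (p : lp (fun _ : ℕ => H) 2 × lp (fun _ : ℕ => H) 2) :
    ∃ v, ∀ a, vectorFunctionalSum M v a = sigmaWeakFunctional M p a := by
  have hsum : Summable fun n => vectorFunctionalLift (p.1 n, p.2 n) := by
    refine Summable.of_norm_bounded ((summable_norm_sq_lp_two p.1).add
      (summable_norm_sq_lp_two p.2)) fun n => ?_
    rw [norm_vectorFunctionalLift]
    nlinarith [sq_nonneg (‖p.1 n‖ - ‖p.2 n‖), sq_nonneg ‖p.1 n‖, sq_nonneg ‖p.2 n‖]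
  refine ⟨∑' n, vectorFunctionalLift (p.1 n, p.2 n), fun a => ?_⟩
  have := hsum.hasSum.mapL ((ContinuousLinearMap.apply ℂ ℂ a).comp (vectorFunctionalSum M))
  refine this.tsum_eq.symm.trans (tsum_congr fun n => ?_)
  rw [ContinuousLinearMap.comp_apply, vectorFunctionalSum_lift]
  rfl

/-- The functionals in the range of `vectorFunctionalSum M` are among those that define the σ-weak
topology: a summable family has countable support, and the coefficients and the normalizing factors
can be distributed over the two vectors. -/
theorem exists_sigmaWeakFunctional_eq_vectorFunctionalSum (v : lp (fun _ : H × H => ℂ) 1) :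
    ∃ p : lp (fun _ : ℕ => H) 2 × lp (fun _ : ℕ => H) 2,
      ∀ a, vectorFunctionalSum M v a = sigmaWeakFunctional M p a := by
  have hv := summable_norm_lp_one v
  have hcount : (Function.support fun q => ‖v q‖).Countable := hv.countable_support
  have := hcount.to_subtype
  obtain ⟨e, he⟩ := exists_injective_nat (Function.support fun q => ‖v q‖)
  -- the vectors `√|v q| ξ / ‖ξ‖` and `(v q / √|v q|) ζ / ‖ζ‖`, for `q = (ξ, ζ)` in the support
  let x (q : Function.support fun q => ‖v q‖) : H :=
    ((√‖v q‖ * ‖(q : H × H).1‖⁻¹ : ℝ) : ℂ) • (q : H × H).1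
  let y (q : Function.support fun q => ‖v q‖) : H :=
    (v q * ((√‖v q‖)⁻¹ * ‖(q : H × H).2‖⁻¹ : ℝ) : ℂ) • (q : H × H).2
  have hsqrt (q : Function.support fun q => ‖v q‖) : 0 < √‖v q‖ :=
    Real.sqrt_pos.2 ((norm_nonneg _).lt_of_ne' q.2)
  have hmem (z : (Function.support fun q => ‖v q‖) → H) (hz : ∀ q, ‖z q‖ ^ 2 ≤ ‖v q‖) :
      Memℓp (Function.extend e z 0) (E := fun _ : ℕ => H) 2 := by
    refine memℓp_gen ?_
    have h1 : Summable fun q => ‖z q‖ ^ 2 :=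
      (hv.subtype _).of_nonneg_of_le (fun q => sq_nonneg _) hz
    refine ((summable_extend_zero he).2 h1).congr fun n => ?_
    by_cases hn : ∃ q, e q = n
    · obtain ⟨q, rfl⟩ := hn
      simp [he.extend_apply]
    · simp [Function.extend_apply' _ _ _ hn]
  have hnx (q) : ‖x q‖ ^ 2 ≤ ‖v q‖ := by
    rw [norm_smul, Complex.norm_real, Real.norm_of_nonneg (by positivity), mul_assoc, mul_pow,
      Real.sq_sqrt (norm_nonneg _)]
    exact mul_le_of_le_one_right (norm_nonneg _)
      (pow_le_one₀ (by positivity) (inv_mul_le_one_of_le₀ le_rfl (norm_nonneg _)))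
  have hny (q) : ‖y q‖ ^ 2 ≤ ‖v q‖ := by
    have : ‖v q‖ * (√‖v q‖)⁻¹ = √‖v q‖ := by
      rw [← div_eq_mul_inv, Real.div_sqrt]
    rw [norm_smul, norm_mul, Complex.norm_real, Real.norm_of_nonneg (by positivity), ← mul_assoc,
      this, mul_assoc, mul_pow, Real.sq_sqrt (norm_nonneg _)]
    exact mul_le_of_le_one_right (norm_nonneg _)
      (pow_le_one₀ (by positivity) (inv_mul_le_one_of_le₀ le_rfl (norm_nonneg _)))
  refine ⟨(⟨_, hmem x hnx⟩, ⟨_, hmem y hny⟩), fun a => ?_⟩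
  have hL : vectorFunctionalSum M v a = ∑' q, v q * normalizedVectorFunctional M q a :=
    ((summable_smul_normalizedVectorFunctional M v).hasSum.mapL
      (ContinuousLinearMap.apply ℂ ℂ a)).tsum_eq.symm
  have hsupp : (Function.support fun q => v q * normalizedVectorFunctional M q a) ⊆
      Function.support fun q => ‖v q‖ := fun q hq =>
    norm_ne_zero_iff.2 (left_ne_zero_of_mul hq)
  rw [hL, ← tsum_subtype_eq_of_support_subset hsupp, ← tsum_extend_zero he]
  refine tsum_congr fun n => ?_
  change _ = ⟪Function.extend e x 0 n, a.toOp (Function.extend e y 0 n)⟫_ℂ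
  by_cases hn : ∃ q, e q = n
  · obtain ⟨q, rfl⟩ := hn
    rw [he.extend_apply, he.extend_apply, he.extend_apply, normalizedVectorFunctional,
      smul_apply, vectorFunctional_apply, map_smul, inner_smul_left,
      inner_smul_right, Complex.conj_ofReal, smul_eq_mul]
    have := (hsqrt q).ne'
    push_cast
    have hc : ((√‖v q‖ : ℝ) : ℂ) ≠ 0 := Complex.ofReal_ne_zero.2 this
    rw [mul_inv]
    field_simp
  · rw [Function.extend_apply' _ _ _ hn, Function.extend_apply' _ _ _ hn]
    simp

/-- The predual is the range of `vectorFunctionalSum M`. -/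
theorem coe_predualSubmodule_eq_range :
    (predualSubmodule M : Set (StrongDual ℂ (VNElem M))) = Set.range (vectorFunctionalSum M) := by
  have hlin (p : lp (fun _ : ℕ => H) 2 × lp (fun _ : ℕ => H) 2) :
      ∃ v, ⇑(vectorFunctionalSum M v) = sigmaWeakFunctional M p := by
    obtain ⟨v, hv⟩ := exists_vectorFunctionalSum_eq_sigmaWeakFunctional M p
    exact ⟨v, funext hv⟩
  choose v hv using hlin
  ext η
  constructor
  · intro hη
    have hspan : (η : VNElem M →ₗ[ℂ] ℂ) ∈ Submodule.span ℂ
        (Set.range fun p => (vectorFunctionalSum M (v p) : VNElem M →ₗ[ℂ] ℂ)) := by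
      rw [LinearMap.mem_span_iff_continuous]
      have htop : (⨅ p, TopologicalSpace.induced
          (vectorFunctionalSum M (v p) : VNElem M →ₗ[ℂ] ℂ) inferInstance) =
          sigmaWeakTopology M := by
        simp only [ContinuousLinearMap.coe_coe, hv]
        exact (induced_to_pi _).symm
      rw [htop]
      exact hη
    have hle : Submodule.span ℂ
        (Set.range fun p => (vectorFunctionalSum M (v p) : VNElem M →ₗ[ℂ] ℂ)) ≤
        ((vectorFunctionalSum M).range).map (ContinuousLinearMap.coeLM ℂ) := by
      rw [Submodule.span_le]
      rintro _ ⟨p, rfl⟩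
      exact ⟨_, ⟨v p, rfl⟩, rfl⟩
    obtain ⟨_, ⟨w, rfl⟩, hw⟩ := hle hspan
    exact ⟨w, ContinuousLinearMap.coe_injective hw⟩
  · rintro ⟨w, rfl⟩
    obtain ⟨p, hp⟩ := exists_sigmaWeakFunctional_eq_vectorFunctionalSum M w
    let := sigmaWeakTopology M
    have h1 : Continuous fun (a : VNElem M) p => sigmaWeakFunctional M p a := continuous_induced_dom
    have h2 : Continuous[sigmaWeakTopology M, inferInstance] fun a => sigmaWeakFunctional M p a :=
      (continuous_apply p).comp h1
    change Continuous[sigmaWeakTopology M, inferInstance] ⇑(vectorFunctionalSum M w)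
    rw [show ⇑(vectorFunctionalSum M w) = _ from funext hp]
    exact h2

/-- The predual of a von Neumann algebra is a Banach space. -/
instance Predual.instCompleteSpace : CompleteSpace (Predual M) := by
  have h : IsClosed (predualSubmodule M : Set (StrongDual ℂ (VNElem M))) := by
    rw [coe_predualSubmodule_eq_range]
    exact isClosed_range_vectorFunctionalSum M
  exact h.completeSpace_coe

end PredualComplete

/-! ### The equivalence -/

/-- A positive functional stays positive if its norm does not grow and its value at `1` does not
change. -/
theorem IsPositiveFunctional.of_norm_le {A : Type*} [CStarAlgebra A] [PartialOrder A]
    [StarOrderedRing A] {η θ : StrongDual ℂ A} (hη : IsPositiveFunctional η) (hn : ‖θ‖ ≤ ‖η‖)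
    (h1 : θ 1 = η 1) : IsPositiveFunctional θ :=
  isPositiveFunctional_of_norm_le hn (h1.trans hη.norm_eq.symm)

theorem corollary2 :
    (∀ (A : Type*) [CStarAlgebra A] [PartialOrder A] [StarOrderedRing A]
      (T : ℝ≥0 → StrongDual ℂ A →L[ℂ] StrongDual ℂ A),
      IsC0StarSemigroup T → IsContractive T →
      (((∀ t η, IsPositiveFunctional η → IsPositiveFunctional (T t η)) ∧
          ∀ t η, T t η 1 = η 1) ↔
        ∀ η : (c0StarGenerator T).domain, c0StarGenerator T η 1 = 0)) ∧
    (∀ (H : Type*) [NormedAddCommGroup H] [InnerProductSpace ℂ H] [CompleteSpace H]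
      (M : VonNeumannAlgebra H) (T : ℝ≥0 → Predual M →L[ℂ] Predual M),
      IsC0Semigroup T → IsContractive T →
      (((∀ t (η : Predual M), IsPositiveFunctional (Predual.toDual η) →
            IsPositiveFunctional (Predual.toDual (T t η))) ∧
          ∀ t (η : Predual M), Predual.toDual (T t η) 1 = Predual.toDual η 1) ↔
        ∀ η : (c0Generator T).domain, Predual.toDual (c0Generator T η) 1 = 0)) := by
  refine ⟨?_, ?_⟩
  · intro A _ _ _ T hT hc
    rw [← hT.invariant_iff hc (1 : A), and_iff_right_iff_imp]
    intro h t η hη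
    exact hη.of_norm_le (((T t).le_of_opNorm_le (hc t) η).trans_eq (one_mul _)) (h t η)
  · intro H _ _ _ M T hT hc
    let e : StrongDual ℂ (Predual M) :=
      (ContinuousLinearMap.apply ℂ ℂ (1 : VNElem M)).comp
        Predual.toDual.toContinuousLinearMap
    have key := hT.invariant_iff hc e
    refine Iff.trans (and_iff_right_iff_imp.2 ?_) key
    intro h t η hη
    refine hη.of_norm_le ?_ (h t η)
    rw [LinearIsometry.norm_map, LinearIsometry.norm_map]
    exact ((T t).le_of_opNorm_le (hc t) η).trans_eq (one_mul _)
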